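/- **Conventions.** Manifolds are smooth, finite-dimensional, Hausdorff and second countable. A *Lie category* $\mathcal D\rightrightarrows\mathcal X$ is a small category whose set of objects $\mathcal X$ is a smooth manifold without boundary and whose set of morphisms $\mathcal D$ is a smooth manifold with or without boundary, such that the source and target maps $s,t\colon\mathcal D\to\mathcal X$ are smooth submersions, the unit map $u\colon\mathcal X\to\mathcal D$ and the composition map $m\colon\mathcal D^{(2)}\to\mathcal D$ on the set $\mathcal D^{(2)}=\{(g,h)\in\mathcal D\times\mathcal D : s(g)=t(h)\}$ of composable pairs are smooth, and, if $\partial\mathcal D\neq\emptyset$, the restrictions $s|_{\partial\mathcal D},t|_{\partial\mathcal D}\colon\partial\mathcal D\to\mathcal X$ are submersions. (A map is a submersion or an immersion if it is smooth and its differential at every point is surjective or injective, respectively.) A subcategory is *wide* if it contains all the units. A Lie category $\mathcal C$ is an *embedded Lie subcategory* of $\mathcal D$, via a functor $F\colon\mathcal C\to\mathcal D$, if $F$ is an injective immersion on morphisms and a homeomorphism onto its image. **Lemma.** Let $\mathcal C$ be a wide subcategory of a Lie category $\mathcal D\rightrightarrows\mathcal X$. Suppose that $\mathcal C$ is also an embedded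 submanifold of $\mathcal D$, with or without boundary (that is, $\mathcal C$ with the subspace topology carries the structure of a smooth manifold with or without boundary for which the inclusion $\mathcal C\hookrightarrow\mathcal D$ is an immersion), that $s|_{\mathcal C},t|_{\mathcal C}\colon\mathcal C\to\mathcal X$ are submersions, and that either 1. $\mathcal C$ has no boundary, or 2. $\mathcal C$ has a boundary, and $s|_{\partial\mathcal C},t|_{\partial\mathcal C}\colon\partial\mathcal C\to\mathcal X$ are submersions. Then $\mathcal C\rightrightarrows\mathcal X$, with the restricted structure maps, is a Lie category, and it is an embedded Lie subcategory of $\mathcal D$ via the inclusion. -/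

import Mathlib

open Set Topology
open scoped Manifold ContDiff

namespace LieCat

section Manifolds

variable {E : Type*} [NormedAddCommGroup E] [NormedSpace ℝ E]
  {H : Type*} [TopologicalSpace H]
  {E' : Type*} [NormedAddCommGroup E'] [NormedSpace ℝ E']
  {H' : Type*} [TopologicalSpace H']

/-- The local model is a full vector space or a closed half-space `{v | 0 ≤ l v}`, `l ≠ 0`.
(Models with corners are excluded.) -/
def IsBoundaryModel (I : ModelWithCorners ℝ E H) : Prop :=
  range I = univ ∨ ∃ l : E →L[ℝ] ℝ, l ≠ 0 ∧ range I = {v | 0 ≤ l v}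

/-- `M`, with its given atlas, is a smooth finite-dimensional (Hausdorff, second-countable)
manifold with or without boundary. -/
structure IsSmoothManifoldWithBoundary (I : ModelWithCorners ℝ E H) (M : Type*)
    [TopologicalSpace M] [ChartedSpace H M] : Prop where
  finiteDimensional : FiniteDimensional ℝ E
  model : IsBoundaryModel I
  smooth : IsManifold I ∞ M
  hausdorff : T2Space M
  secondCountable : SecondCountableTopology M

/-- `M` is a smooth manifold without boundary. -/
structure IsSmoothManifoldWithoutBoundary (I : ModelWithCorners ℝ E H) (M : Type*)
    [TopologicalSpace M] [ChartedSpace H M] : Prop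
    extends IsSmoothManifoldWithBoundary I M where
  boundary_eq_empty : I.boundary M = ∅

variable (I : ModelWithCorners ℝ E H) (I' : ModelWithCorners ℝ E' H')
  {M : Type*} [TopologicalSpace M] [ChartedSpace H M]
  {M' : Type*} [TopologicalSpace M'] [ChartedSpace H' M']

/-- `f` is a smooth submersion: smooth, with surjective differential at every point. -/
structure IsSubmersion (f : M → M') : Prop where
  smooth : ContMDiff I I' ∞ f
  surjective : ∀ p : M, Function.Surjective (mfderiv I I' f p)

/-- `f` is a smooth immersion: smooth, with injective differential at every point. -/
structure IsImmersion (f : M → M') : Prop where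
  smooth : ContMDiff I I' ∞ f
  injective : ∀ p : M, Function.Injective (mfderiv I I' f p)

/-- `f` is a smooth embedding: a smooth immersion that is a homeomorphism onto its image. -/
structure IsSmoothEmbedding (f : M → M') : Prop where
  immersion : IsImmersion I I' f
  embedding : IsEmbedding f

/-- For a boundary point `p`, the tangent space `T_p ∂M ⊆ T_p M`. In the chart at `p` the boundary
`∂M` is the hyperplane `frontier (range I)`, and `T_p M` is read in that chart; so the tangent
vectors to `∂M` are the directions of that hyperplane. -/
def boundaryTangentSpace (p : M) : Set (TangentSpace I p) :=
  {v : E | extChartAt I p p + v ∈ frontier (range I)}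

/-- In a half-space model `{v | 0 ≤ l v}` the boundary tangent space is the kernel of `l`. -/
theorem boundaryTangentSpace_eq_ker {l : E →L[ℝ] ℝ} (hl : l ≠ 0)
    (hI : range I = {v | 0 ≤ l v}) {p : M} (hp : p ∈ I.boundary M) :
    boundaryTangentSpace I p = {v : E | l v = 0} := by
  have hfr : frontier (range I) = {v | l v = 0} := by
    have h1 : range I = l ⁻¹' Ici 0 := hI
    rw [h1, ← (l.isOpenMap_of_ne_zero hl).preimage_frontier_eq_frontier_preimage l.continuous,
      frontier_Ici]
    rfl
  have hp' : l (extChartAt I p p) = 0 := by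
    have h2 : extChartAt I p p ∈ frontier (range I) := hp
    rwa [hfr] at h2
  ext v
  change (extChartAt I p p + (show E from v) : E) ∈ frontier (range I) ↔ l (show E from v) = 0
  rw [hfr, mem_ofPred_eq, map_add, hp', zero_add]

/-- The restriction of the smooth map `f` to `∂M` is a submersion: at each `p ∈ ∂M`, the
differential `d(f|_{∂M})_p`, i.e. `df_p` restricted to `T_p ∂M`, is onto. -/
def IsBoundarySubmersion (f : M → M') : Prop :=
  ∀ p ∈ I.boundary M, ∀ w : TangentSpace I' (f p),
    ∃ v ∈ boundaryTangentSpace I p, mfderiv I I' f p v = w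

/-- Smoothness of a map that is defined only on a subset `S` of `M`. It is `ContMDiffOn` for one
(equivalently, every) extension of the map by arbitrary values; when `S` is an embedded
submanifold (with corners), it is smoothness for the submanifold structure of `S`, see
`smoothOnSubset_iff`. -/
def SmoothOnSubset {S : Set M} (f : S → M') : Prop :=
  ∃ F : M → M', (∀ p : S, F p = f p) ∧ ContMDiffOn I I' ∞ F S

/-- If `N ≃ S` makes `S` a submanifold of `M`, i.e. around every point there are charts `ψ` of `M`
and `φ` of `N` such that `ψ` restricted to the submanifold becomes `φ` after a linear map `A`
(a projection onto the linear subspace in which an adapted chart takes `S`), then smoothness on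
the subset `S` is smoothness on the manifold `N`. -/
theorem smoothOnSubset_iff {E₂ : Type*} [NormedAddCommGroup E₂] [NormedSpace ℝ E₂]
    {H₂ : Type*} [TopologicalSpace H₂] {J : ModelWithCorners ℝ E₂ H₂}
    {N : Type*} [TopologicalSpace N] [ChartedSpace H₂ N] [Nonempty M']
    {S : Set M} (e : N ≃ₜ S) (he : ContMDiff J I ∞ fun q => (e q : M))
    (hadapted : ∀ q : N, ∃ φ ∈ IsManifold.maximalAtlas J ∞ N,
      ∃ ψ ∈ IsManifold.maximalAtlas I ∞ M, ∃ A : E →L[ℝ] E₂, q ∈ φ.source ∧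
        ∀ q' ∈ φ.source, (e q' : M) ∈ ψ.source ∧ A (ψ.extend I (e q')) = φ.extend J q')
    (f : S → M') :
    SmoothOnSubset I I' f ↔ ContMDiff J I' ∞ (f ∘ e) := by
  constructor
  · rintro ⟨F, hF, hs⟩
    have h := hs.comp_contMDiff he fun q => (e q).2
    exact h.congr fun q => (hF (e q)).symm
  · intro h
    classical
    refine ⟨Function.extend Subtype.val f fun _ => Classical.arbitrary M',
      fun p => Subtype.val_injective.extend_apply _ _ p, fun x hx => ?_⟩
    obtain ⟨φ, hφ, ψ, hψ, A, hq, hA⟩ := hadapted (e.symm ⟨x, hx⟩)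
    have hU : ∃ U : Set M, IsOpen U ∧ Subtype.val ⁻¹' U = e '' φ.source :=
      isOpen_induced_iff.1 (e.isOpenMap _ φ.open_source)
    obtain ⟨U, hUo, hU⟩ := hU
    have hmem : ∀ y (hy : y ∈ S), y ∈ U → e.symm ⟨y, hy⟩ ∈ φ.source := by
      intro y hy hyU
      have h1 : (⟨y, hy⟩ : S) ∈ e '' φ.source := hU ▸ (show (⟨y, hy⟩ : S) ∈ Subtype.val ⁻¹' U from hyU)
      obtain ⟨q', hq', h2⟩ := h1
      rw [← h2]; simpa using hq'
    have hxU : x ∈ U := by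
      have h1 : (⟨x, hx⟩ : S) ∈ Subtype.val ⁻¹' U := hU ▸ ⟨_, hq, by simp⟩
      exact h1
    have key : ∀ y (hy : y ∈ S), y ∈ U → y ∈ ψ.source ∧
        A (ψ.extend I y) = φ.extend J (e.symm ⟨y, hy⟩) := by
      intro y hy hyU
      simpa using hA _ (hmem y hy hyU)
    have hr : ContMDiffOn I I' ∞
        ((f ∘ e) ∘ (φ.extend J).symm ∘ A ∘ ψ.extend I) (S ∩ U) := by
      refine h.comp_contMDiffOn ((contMDiffOn_extend_symm hφ).comp (A.contMDiff.comp_contMDiffOn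
        ((I.contMDiff.comp_contMDiffOn (contMDiffOn_of_mem_maximalAtlas hψ)).mono fun y hy => (key y hy.1 hy.2).1)) ?_)
      intro y hy
      have h1 := (key y hy.1 hy.2).2
      change A (ψ.extend I y) ∈ J '' φ.target
      rw [h1]
      exact ⟨φ (e.symm ⟨y, hy.1⟩), φ.map_source (hmem y hy.1 hy.2), rfl⟩
    have hc : ContMDiffOn I I' ∞
        (Function.extend Subtype.val f fun _ => Classical.arbitrary M') (S ∩ U) := by
      refine hr.congr fun y hy => ?_
      have h1 := (key y hy.1 hy.2).2
      have h2 : (φ.extend J).symm (φ.extend J (e.symm ⟨y, hy.1⟩)) = e.symm ⟨y, hy.1⟩ :=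
        φ.extend_left_inv (hmem y hy.1 hy.2)
      simp only [Function.comp_apply]
      rw [h1, h2, e.apply_symm_apply]
      exact Subtype.val_injective.extend_apply _ _ (⟨y, hy.1⟩ : S)
    exact (contMDiffWithinAt_inter (hUo.mem_nhds hxU)).1 (hc x ⟨hx, hxU⟩)

end Manifolds

/-- A small category with set of objects `Obj` and set of all morphisms `Mor`; `comp g h` is the
composite `g ∘ h`, defined when the source of `g` is the target of `h`. -/
structure SmallCat (Obj Mor : Type*) where
  src : Mor → Obj
  tgt : Mor → Obj
  unit : Obj → Mor
  comp : ∀ g h : Mor, src g = tgt h → Mor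
  src_unit : ∀ x, src (unit x) = x
  tgt_unit : ∀ x, tgt (unit x) = x
  src_comp : ∀ g h p, src (comp g h p) = src h
  tgt_comp : ∀ g h p, tgt (comp g h p) = tgt g
  comp_unit : ∀ g, comp g (unit (src g)) (tgt_unit (src g)).symm = g
  unit_comp : ∀ g, comp (unit (tgt g)) g (src_unit (tgt g)) = g
  assoc : ∀ (g h k : Mor) (p : src g = tgt h) (q : src h = tgt k),
    comp (comp g h p) k ((src_comp g h p).trans q) =
      comp g (comp h k q) (p.trans (tgt_comp h k q).symm)

namespace SmallCat

variable {X C : Type*} (K : SmallCat X C)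

/-- The set of composable pairs. -/
def composable : Set (C × C) := {p | K.src p.1 = K.tgt p.2}

/-- The composition map, on composable pairs. -/
def mul : K.composable → C := fun p => K.comp p.1.1 p.1.2 p.2

/-- A set of morphisms is a wide subcategory if it contains all the units and is closed under
composition. -/
structure IsWideSubcategory (S : Set C) : Prop where
  unit_mem : ∀ x, K.unit x ∈ S
  comp_mem : ∀ g h p, g ∈ S → h ∈ S → K.comp g h p ∈ S

/-- A wide subcategory, as a category in its own right. -/
def restrict {S : Set C} (hS : K.IsWideSubcategory S) : SmallCat X S where
  src g := K.src g
  tgt g := K.tgt g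
  unit x := ⟨K.unit x, hS.unit_mem x⟩
  comp g h p := ⟨K.comp g h p, hS.comp_mem _ _ p g.2 h.2⟩
  src_unit := K.src_unit
  tgt_unit := K.tgt_unit
  src_comp _ _ p := K.src_comp _ _ p
  tgt_comp _ _ p := K.tgt_comp _ _ p
  comp_unit g := Subtype.ext (K.comp_unit g)
  unit_comp g := Subtype.ext (K.unit_comp g)
  assoc g h k p q := Subtype.ext (K.assoc g h k p q)

end SmallCat

/-- A functor between small categories. -/
structure SmallFunctor {X C Y D : Type*} (K : SmallCat X C) (L : SmallCat Y D) where
  obj : X → Y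
  mor : C → D
  src_mor : ∀ g, L.src (mor g) = obj (K.src g)
  tgt_mor : ∀ g, L.tgt (mor g) = obj (K.tgt g)
  mor_unit : ∀ x, mor (K.unit x) = L.unit (obj x)
  mor_comp : ∀ g h (p : K.src g = K.tgt h),
    mor (K.comp g h p) =
      L.comp (mor g) (mor h) ((src_mor g).trans ((congrArg obj p).trans (tgt_mor h).symm))

/-- The inclusion functor of a wide subcategory. -/
def SmallCat.inclusion {X C : Type*} (K : SmallCat X C) {S : Set C}
    (hS : K.IsWideSubcategory S) : SmallFunctor (K.restrict hS) K where
  obj := id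
  mor := Subtype.val
  src_mor _ := rfl
  tgt_mor _ := rfl
  mor_unit _ := rfl
  mor_comp _ _ _ := rfl

section LieCategories

variable {EX : Type*} [NormedAddCommGroup EX] [NormedSpace ℝ EX]
  {HX : Type*} [TopologicalSpace HX] (IX : ModelWithCorners ℝ EX HX)
  {X : Type*} [TopologicalSpace X] [ChartedSpace HX X]
  {EC : Type*} [NormedAddCommGroup EC] [NormedSpace ℝ EC]
  {HC : Type*} [TopologicalSpace HC] (IC : ModelWithCorners ℝ EC HC)
  {C : Type*} [TopologicalSpace C] [ChartedSpace HC C]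

/-- A Lie category: the morphisms form a smooth manifold with or without boundary, the objects
form a smooth manifold without boundary, source and target are smooth submersions, units and
composition are smooth, and the boundary is regular, i.e. source and target restrict to
submersions on the boundary of the manifold of morphisms (no condition if it is empty). -/
structure IsLieCategory (K : SmallCat X C) : Prop where
  objects : IsSmoothManifoldWithoutBoundary IX X
  morphisms : IsSmoothManifoldWithBoundary IC C
  src_submersion : IsSubmersion IC IX K.src
  tgt_submersion : IsSubmersion IC IX K.tgt
  unit_smooth : ContMDiff IX IC ∞ K.unit
  comp_smooth : SmoothOnSubset (IC.prod IC) IC K.mul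
  src_boundary : IsBoundarySubmersion IC IX K.src
  tgt_boundary : IsBoundarySubmersion IC IX K.tgt

variable {EY : Type*} [NormedAddCommGroup EY] [NormedSpace ℝ EY]
  {HY : Type*} [TopologicalSpace HY] (IY : ModelWithCorners ℝ EY HY)
  {Y : Type*} [TopologicalSpace Y] [ChartedSpace HY Y]
  {ED : Type*} [NormedAddCommGroup ED] [NormedSpace ℝ ED]
  {HD : Type*} [TopologicalSpace HD] (ID : ModelWithCorners ℝ ED HD)
  {D : Type*} [TopologicalSpace D] [ChartedSpace HD D]

/-- The functor `F` exhibits `K` as a Lie subcategory of `L`: both are Lie categories, and `F` is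
smooth, injective and immersive. -/
structure IsLieSubcategory {K : SmallCat X C} {L : SmallCat Y D} (F : SmallFunctor K L) :
    Prop where
  source : IsLieCategory IX IC K
  target : IsLieCategory IY ID L
  injective : Function.Injective F.mor
  immersion : IsImmersion IC ID F.mor

/-- The functor `F` exhibits `K` as an embedded Lie subcategory of `L`. -/
structure IsEmbeddedLieSubcategory {K : SmallCat X C} {L : SmallCat Y D}
    (F : SmallFunctor K L) : Prop extends IsLieSubcategory IX IC IY ID F where
  embedding : IsSmoothEmbedding IC ID F.mor

end LieCategories

end LieCat

/-! Source, target and the boundary conditions are given on `C`. What remains is that units and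
composition, smooth as maps into `D`, are smooth as maps into `C`. The subspace topology gives their
continuity into `C`, so it is enough that a continuous map whose composite with an immersion is
smooth is itself smooth (`IsImmersion.contMDiffWithinAt_of_comp`).

Boundaries rule out a routine appeal to slice charts: `∂C` may meet the interior of `D`, or `C` may
touch `∂D`. Instead, in charts, the immersion is followed by a linear left inverse `A` of its
differential at the point. The result is a map from part of a half-space to a space of the same
dimension, with identity differential there, and it has a local inverse `h`. Its image can be an
irregular set, so `h` is shown smooth on that set as it is; near the point, `h ∘ A` then recovers
the coordinates of `C` smoothly from those of `D`. -/

namespace LieCat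

/-! ### Smooth local inverses on sets that need not be open -/

section LocalInverse

variable {E F : Type*} [NormedAddCommGroup E] [NormedSpace ℝ E]
  [NormedAddCommGroup F] [NormedSpace ℝ F]

/-- A continuous left inverse, on the image of `s`, of a smooth map with invertible differentials
is smooth. The image `f '' s` is an arbitrary set: no unique differentiability is needed. -/
theorem contDiffOn_leftInverse_image [CompleteSpace E] {s : Set E} {f : E → F} {h : F → E}
    (hs : UniqueDiffOn ℝ s) (hf : ContDiffOn ℝ ∞ f s)
    (hinv : ∀ y ∈ s, (fderivWithin ℝ f s y).IsInvertible)
    (hh : LeftInvOn h f s) (hc : ContinuousOn h (f '' s)) :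
    ContDiffOn ℝ ∞ h (f '' s) := by
  have hmaps : MapsTo h (f '' s) s := by
    rintro _ ⟨y, hy, rfl⟩
    rwa [hh hy]
  have hderiv : ∀ z ∈ f '' s,
      HasFDerivWithinAt h (fderivWithin ℝ f s (h z)).inverse (f '' s) z := by
    intro z hz
    obtain ⟨e, he⟩ := hinv (h z) (hmaps hz)
    rw [← he, ContinuousLinearMap.inverse_equiv]
    refine HasFDerivWithinAt.of_local_left_inverse (f := f) (t := s) ((hc z hz).tendsto_nhdsWithin hmaps)
      ?_ hz ?_
    · rw [he]
      exact (hf.differentiableOn (by simp) _ (hmaps hz)).hasFDerivWithinAt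
    · filter_upwards [self_mem_nhdsWithin] with w hw
      obtain ⟨y, hy, rfl⟩ := hw
      rw [hh hy]
  have hf' : ContDiffOn ℝ ∞ (fderivWithin ℝ f s) s := hf.fderivWithin hs (by simp)
  rw [contDiffOn_infty]
  -- Bootstrap: if `h` is of class `n`, so is `z ↦ (f' (h z))⁻¹`, hence `h` is of class `n + 1`. The
  -- criterion accepts any derivative field, so derivatives within `f '' s` need not be unique.
  intro n
  induction n with
  | zero => exact contDiffOn_zero.2 hc
  | succ n ih =>
    intro z hz
    rw [Nat.cast_add, Nat.cast_one, contDiffWithinAt_succ_iff_hasFDerivWithinAt' (by simp),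
      insert_eq_of_mem hz]
    refine ⟨f '' s, self_mem_nhdsWithin, Subset.rfl, by simp, _, hderiv, ?_⟩
    exact (hinv (h z) (hmaps hz)).contDiffAt_map_inverse.comp_contDiffWithinAt z
      (((hf'.of_le (by exact_mod_cast le_top)).comp ih hmaps) z hz)

/-- Inverse function theorem on a convex set with the unique differential property (for example
the intersection of a half-space and a ball). -/
theorem exists_contDiffOn_leftInverse_of_convex [CompleteSpace E] {s : Set E} {f : E → F}
    {x : E} (hconv : Convex ℝ s) (hs : UniqueDiffOn ℝ s) (hf : ContDiffOn ℝ ∞ f s) (hx : x ∈ s)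
    (hinv : (fderivWithin ℝ f s x).IsInvertible) :
    ∃ W ∈ 𝓝[s] x, W ⊆ s ∧ ∃ h : F → E, LeftInvOn h f W ∧ ContDiffOn ℝ ∞ h (f '' W) := by
  obtain ⟨e, he⟩ := hinv
  -- A perturbation of `e` with Lipschitz constant below `‖e⁻¹‖⁻¹` stays injective with continuous
  -- inverse; if `E` is trivial any positive `c` will do.
  obtain ⟨c, hc0, hc⟩ : ∃ c : NNReal, 0 < c ∧
      (Subsingleton E ∨ c < ‖(e.symm : F →L[ℝ] E)‖₊⁻¹) := by
    rcases e.subsingleton_or_nnnorm_symm_pos with h | h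
    · exact ⟨1, one_pos, Or.inl h⟩
    · obtain ⟨c, h1, h2⟩ := exists_between (inv_pos.2 h)
      exact ⟨c, h1, Or.inr h2⟩
  have hcont : ContinuousWithinAt (fderivWithin ℝ f s) s x :=
    hf.continuousOn_fderivWithin hs (by simp) x hx
  have hball : ∀ᶠ y in 𝓝[s] x, ‖fderivWithin ℝ f s y - (e : E →L[ℝ] F)‖ ≤ c ∧
      (fderivWithin ℝ f s y).IsInvertible := by
    have h1 := hcont.eventually (p := fun A => ‖A - (e : E →L[ℝ] F)‖ ≤ c) (by
      rw [← he]
      filter_upwards [Metric.closedBall_mem_nhds (e : E →L[ℝ] F) (NNReal.coe_pos.2 hc0)] with A hA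
      simpa [dist_eq_norm] using hA)
    have h2 := hcont.eventually (p := fun A => A.IsInvertible) (by
      rw [← he]
      exact e.nhds)
    exact h1.and h2
  obtain ⟨r, hr, hrs⟩ := Metric.mem_nhdsWithin_iff.1 hball
  have hWs : s ∩ Metric.ball x r ⊆ s := inter_subset_left
  have hW : s ∩ Metric.ball x r ∈ 𝓝[s] x :=
    inter_mem_nhdsWithin s (Metric.ball_mem_nhds x hr)
  have hWu : UniqueDiffOn ℝ (s ∩ Metric.ball x r) := hs.inter Metric.isOpen_ball
  have hWd : ∀ y ∈ s ∩ Metric.ball x r,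
      HasFDerivWithinAt f (fderivWithin ℝ f s y) (s ∩ Metric.ball x r) y := fun y hy =>
    ((hf.differentiableOn (by simp) y hy.1).hasFDerivWithinAt).mono hWs
  -- Convexity enters here, through the mean value inequality.
  have happ : ApproximatesLinearOn f (e : E →L[ℝ] F) (s ∩ Metric.ball x r) c := by
    intro y hy z hz
    exact Convex.norm_image_sub_le_of_norm_hasFDerivWithin_le' hWd
      (fun w hw => (hrs ⟨hw.2, hw.1⟩).1) (hconv.inter (convex_ball x r)) hz hy
  refine ⟨_, hW, hWs, (happ.toPartialEquiv hc).symm, fun y hy =>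
    (happ.toPartialEquiv hc).left_inv hy, ?_⟩
  refine contDiffOn_leftInverse_image hWu (hf.mono hWs) (fun y hy => ?_)
    (fun y hy => (happ.toPartialEquiv hc).left_inv hy) (happ.inverse_continuousOn hc)
  rw [(hWd y hy).fderivWithin (hWu y hy)]
  exact (hrs ⟨hy.2, hy.1⟩).2

end LocalInverse

/-! ### Lifting smoothness through immersions and embeddings -/

section Lifting

variable {E : Type*} [NormedAddCommGroup E] [NormedSpace ℝ E]
  {H : Type*} [TopologicalSpace H] {I : ModelWithCorners ℝ E H}
  {M : Type*} [TopologicalSpace M] [ChartedSpace H M]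
  {E' : Type*} [NormedAddCommGroup E'] [NormedSpace ℝ E']
  {H' : Type*} [TopologicalSpace H'] {J : ModelWithCorners ℝ E' H'}
  {N : Type*} [TopologicalSpace N] [ChartedSpace H' N]
  {G : Type*} [NormedAddCommGroup G] [NormedSpace ℝ G]
  {B : Type*} [TopologicalSpace B] {L : ModelWithCorners ℝ G B}
  {P : Type*} [TopologicalSpace P] [ChartedSpace B P]

/-- In the chart at `q`, an immersion has a local left inverse that factors through a chart of the
target and is smooth on the image. -/
theorem IsImmersion.exists_local_leftInverse [FiniteDimensional ℝ E] [FiniteDimensional ℝ E']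
    [IsManifold I ∞ M] [IsManifold J ∞ N] {i : N → M} (hi : IsImmersion J I i) (q : N) :
    ∃ U ∈ 𝓝 q, ∃ (A : E →L[ℝ] E') (h : E' → E'),
      (∀ q' ∈ U, h (A (extChartAt I (i q) (i q'))) = extChartAt J q q') ∧
      ContDiffOn ℝ ∞ h ((fun q' => A (extChartAt I (i q) (i q'))) '' U) := by
  have hmd : MDifferentiableAt J I i q := hi.smooth.mdifferentiableAt (by simp)
  set g : E' → E := extChartAt I (i q) ∘ i ∘ (extChartAt J q).symm with hg
  have hginj : Function.Injective (fderivWithin ℝ g (range J) (extChartAt J q q)) := by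
    have := hi.injective q
    rwa [hmd.mfderiv] at this
  obtain ⟨A₀, hA₀⟩ := LinearMap.exists_leftInverse_of_injective
    (fderivWithin ℝ g (range J) (extChartAt J q q)).toLinearMap (LinearMap.ker_eq_bot.2 hginj)
  set A : E →L[ℝ] E' := LinearMap.toContinuousLinearMap A₀ with hA
  have hgs : ContDiffOn ℝ ∞ g ((extChartAt J q).target ∩
      (extChartAt J q).symm ⁻¹' (i ⁻¹' (extChartAt I (i q)).source)) :=
    (contMDiff_iff.1 hi.smooth).2 q (i q)
  have hnhds : (extChartAt J q).target ∩
      (extChartAt J q).symm ⁻¹' (i ⁻¹' (extChartAt I (i q)).source)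
      ∈ 𝓝[range J] (extChartAt J q q) := by
    refine Filter.inter_mem (extChartAt_target_mem_nhdsWithin q) ?_
    refine mem_nhdsWithin_of_mem_nhds ((continuousAt_extChartAt_symm q).preimage_mem_nhds ?_)
    rw [extChartAt_to_inv]
    exact hi.smooth.continuous.continuousAt.preimage_mem_nhds (extChartAt_source_mem_nhds (i q))
  obtain ⟨r, hr, hrs⟩ := Metric.mem_nhdsWithin_iff.1 hnhds
  -- Cutting the model's range with a ball keeps the domain convex and keeps unique
  -- differentiability.
  set s : Set E' := range J ∩ Metric.ball (extChartAt J q q) r with hs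
  have hsub : s ⊆ (extChartAt J q).target ∩
      (extChartAt J q).symm ⁻¹' (i ⁻¹' (extChartAt I (i q)).source) := fun y hy =>
    hrs ⟨hy.2, hy.1⟩
  have hx : extChartAt J q q ∈ s := ⟨mem_range_self _, Metric.mem_ball_self hr⟩
  have hsu : UniqueDiffOn ℝ s := J.uniqueDiffOn.inter Metric.isOpen_ball
  have hAg : ContDiffOn ℝ ∞ (A ∘ g) s := A.contDiff.comp_contDiffOn (hgs.mono hsub)
  have hdg : HasFDerivWithinAt g (fderivWithin ℝ g (range J) (extChartAt J q q)) s
      (extChartAt J q q) :=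
    ((hgs.mono hsub).differentiableOn (by simp) _ hx).hasFDerivWithinAt.congr_fderiv
      (fderivWithin_inter (Metric.ball_mem_nhds _ hr))
  have hinv : (fderivWithin ℝ (A ∘ g) s (extChartAt J q q)).IsInvertible := by
    rw [(A.hasFDerivAt.comp_hasFDerivWithinAt _ hdg).fderivWithin (hsu _ hx)]
    refine ⟨ContinuousLinearEquiv.refl ℝ E', ?_⟩
    ext v
    exact (LinearMap.congr_fun hA₀ v).symm
  have : CompleteSpace E' := FiniteDimensional.complete ℝ E'
  obtain ⟨W, hW, hWs, h, hh, hhs⟩ := exists_contDiffOn_leftInverse_of_convex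
    (J.convex_range.inter (convex_ball _ r)) hsu hAg hx hinv
  have hWr : W ∈ 𝓝[range J] (extChartAt J q q) :=
    nhdsWithin_le_of_mem (inter_mem_nhdsWithin _ (Metric.ball_mem_nhds _ hr)) hW
  refine ⟨(extChartAt J q).source ∩ extChartAt J q ⁻¹' W, ?_, A, h, ?_, ?_⟩
  · refine Filter.inter_mem (extChartAt_source_mem_nhds q) ?_
    have h1 : Filter.Tendsto (extChartAt J q) (𝓝 q) (𝓝[range J] (extChartAt J q q)) :=
      tendsto_nhdsWithin_iff.2 ⟨continuousAt_extChartAt q, .of_forall fun y => mem_range_self _⟩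
    exact h1 hWr
  · intro q' hq'
    have h1 := hh hq'.2
    simpa only [hg, Function.comp_apply, (extChartAt J q).left_inv hq'.1] using h1
  · refine hhs.mono ?_
    rintro _ ⟨q', hq', rfl⟩
    refine ⟨extChartAt J q q', hq'.2, ?_⟩
    simp only [hg, Function.comp_apply, (extChartAt J q).left_inv hq'.1]

/-- A continuous map into an immersed manifold (both manifolds possibly with boundary) is smooth
if its composition with the immersion is. -/
theorem IsImmersion.contMDiffWithinAt_of_comp [FiniteDimensional ℝ E] [FiniteDimensional ℝ E']
    [IsManifold I ∞ M] [IsManifold J ∞ N] {i : N → M} (hi : IsImmersion J I i)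
    {f : P → N} {S : Set P} {x : P} (hf : ContinuousWithinAt f S x)
    (h : ContMDiffWithinAt L I ∞ (i ∘ f) S x) : ContMDiffWithinAt L J ∞ f S x := by
  obtain ⟨U, hU, A, k, hk, hks⟩ := hi.exists_local_leftInverse (f x)
  refine contMDiffWithinAt_iff_target.2 ⟨hf, ?_⟩
  -- Continuity of `f` into `N` is essential: it keeps nearby values inside `U`, where the left
  -- inverse is valid.
  have hV : S ∩ f ⁻¹' U ∈ 𝓝[S] x := Filter.inter_mem self_mem_nhdsWithin (hf hU)
  have h1 : ContMDiffWithinAt L 𝓘(ℝ, E') ∞ (A ∘ extChartAt I (i (f x)) ∘ (i ∘ f)) S x :=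
    A.contMDiff.contMDiffAt.comp_contMDiffWithinAt x (contMDiffWithinAt_iff_target.1 h).2
  have h2 : ContMDiffWithinAt L 𝓘(ℝ, E') ∞
      (k ∘ (A ∘ extChartAt I (i (f x)) ∘ (i ∘ f))) (S ∩ f ⁻¹' U) x :=
    ContMDiffWithinAt.comp x (t := (fun q' => A (extChartAt I (i (f x)) (i q'))) '' U)
      (hks _ (mem_image_of_mem _ (mem_of_mem_nhds hU))).contMDiffWithinAt
      (h1.mono inter_subset_left) fun y hy => mem_image_of_mem _ hy.2
  exact (h2.congr (fun y hy => (hk _ hy.2).symm)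
    (hk _ (mem_of_mem_nhds hU)).symm).mono_of_mem_nhdsWithin hV

/-- A map into an embedded manifold is smooth on a set if its composition with the embedding
is. -/
theorem IsSmoothEmbedding.contMDiffOn_of_comp [FiniteDimensional ℝ E] [FiniteDimensional ℝ E']
    [IsManifold I ∞ M] [IsManifold J ∞ N] {i : N → M} (hi : IsSmoothEmbedding J I i)
    {f : P → N} {S : Set P} (h : ContMDiffOn L I ∞ (i ∘ f) S) : ContMDiffOn L J ∞ f S :=
  fun x hx => hi.immersion.contMDiffWithinAt_of_comp
    (hi.embedding.continuousWithinAt_iff.2 (h x hx).continuousWithinAt) (h x hx)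

end Lifting

end LieCat

/-! ### The restricted structure maps -/

theorem mainTheorem11
    {EX : Type*} [NormedAddCommGroup EX] [NormedSpace ℝ EX]
    {HX : Type*} [TopologicalSpace HX] (IX : ModelWithCorners ℝ EX HX)
    {X : Type*} [TopologicalSpace X] [ChartedSpace HX X]
    {ED : Type*} [NormedAddCommGroup ED] [NormedSpace ℝ ED]
    {HD : Type*} [TopologicalSpace HD] (ID : ModelWithCorners ℝ ED HD)
    {D : Type*} [TopologicalSpace D] [ChartedSpace HD D]
    (K : LieCat.SmallCat X D) (hK : LieCat.IsLieCategory IX ID K)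
    (C : Set D) (hC : K.IsWideSubcategory C)
    {EC : Type*} [NormedAddCommGroup EC] [NormedSpace ℝ EC]
    {HC : Type*} [TopologicalSpace HC] (IC : ModelWithCorners ℝ EC HC)
    [ChartedSpace HC C]
    (hman : LieCat.IsSmoothManifoldWithBoundary IC C)
    (hemb : LieCat.IsSmoothEmbedding IC ID (Subtype.val : C → D))
    (hsrc : LieCat.IsSubmersion IC IX (fun g : C => K.src g))
    (htgt : LieCat.IsSubmersion IC IX (fun g : C => K.tgt g))
    (hbd : IC.boundary C = ∅ ∨
      (LieCat.IsBoundarySubmersion IC IX (fun g : C => K.src g) ∧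
        LieCat.IsBoundarySubmersion IC IX (fun g : C => K.tgt g))) :
    LieCat.IsEmbeddedLieSubcategory IX IC IX ID (K.inclusion hC) := by
  have := hman.finiteDimensional
  have := hman.smooth
  have := hK.morphisms.finiteDimensional
  have := hK.morphisms.smooth
  refine ⟨⟨⟨hK.objects, hman, hsrc, htgt, ?_, ?_, ?_, ?_⟩, hK, Subtype.val_injective,
    hemb.immersion⟩, hemb⟩
  · exact contMDiffOn_univ.1 (hemb.contMDiffOn_of_comp (contMDiffOn_univ.2 hK.unit_smooth))
  · classical
    obtain ⟨F, hF, hFs⟩ := hK.comp_smooth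
    -- The value `p.1` off the composable pairs is arbitrary, since smoothness is tested only on
    -- that set.
    refine ⟨fun p => if hp : p ∈ (K.restrict hC).composable then (K.restrict hC).mul ⟨p, hp⟩
      else p.1, fun p => dif_pos p.2, ?_⟩
    have hincl : ContMDiff (IC.prod IC) (ID.prod ID) ∞
        (Prod.map Subtype.val Subtype.val : C × C → D × D) :=
      hemb.immersion.smooth.prodMap hemb.immersion.smooth
    refine hemb.contMDiffOn_of_comp ((hFs.comp hincl.contMDiffOn fun p hp => hp).congr ?_)
    intro p hp
    have hp' : p ∈ (K.restrict hC).composable := hp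
    simp only [Function.comp_apply, dif_pos hp']
    exact (hF ⟨Prod.map Subtype.val Subtype.val p, hp⟩).symm
  · rcases hbd with h | h
    · intro p hp
      simp [h] at hp
    · exact h.1
  · rcases hbd with h | h
    · intro p hp
      simp [h] at hp
    · exact h.2
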